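/- Let $\mathbb N=\{1,2,3,\dots\}$ and let $w=(w(n))_{n\in\mathbb N}$ be a bounded, strictly positive sequence. Let $\ell_1(w)$ be the complex Banach space of all $x\in\mathbb C^{\mathbb N}$ with $\|x\|_{1,w}:=\sum_{n=1}^\infty w(n)|x_n|<\infty$, and let $C$ be the discrete Cesàro operator on $\mathbb C^{\mathbb N}$, $(Cx)_n:=\frac{x_1+\dots+x_n}{n}$. Suppose that $C$ acts in $\ell_1(w)$, i.e. maps $\ell_1(w)$ into itself; then $C$ is automatically continuous on $\ell_1(w)$, and $C^{(1,w)}\in\mathcal L(\ell_1(w))$ denotes the operator so obtained, with spectrum $\sigma(C^{(1,w)})$, resolvent set $\rho(C^{(1,w)})$ and set of eigenvalues $\sigma_{pt}(C^{(1,w)})$. Put $\Sigma:=\{\frac1m: m\in\mathbb N\}$, $\Sigma_0:=\Sigma\cup\{0\}$, $R_w:=\{t\in\mathbb R:\sum_{n=1}^\infty n^t w(n)<\infty\}$ and, if $R_w\neq\mathbb R$, $t_0:=\sup R_w$. (i) $\Sigma\subseteq\Sigma_0\subseteq\sigma(C^{(1,w)})$. (ii) Let $\lambda\in\mathbb C\setminus\Sigma_0$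 and $\alpha:=\operatorname{Re}(1/\lambda)$. Then $\lambda\in\rho(C^{(1,w)})$ if and only if $$\sup_{m\in\mathbb N}\frac{1}{m^\alpha w(m)}\sum_{n=m+1}^\infty\frac{w(n)}{n^{1-\alpha}}<\infty .$$ (iii) If $R_w\neq\mathbb R$, then $t_0$ is finite and $$\Big\{\tfrac1m: m\in\mathbb N,\ m-1\in R_w\Big\}=\sigma_{pt}(C^{(1,w)})\subseteq\Big\{\tfrac1m: m\in\mathbb N,\ 1\le m\le t_0+1\Big\};$$ in particular $\sigma_{pt}(C^{(1,w)})$ is a finite (possibly empty) subset of $\Sigma$. If $R_w=\mathbb R$, then $\sigma_{pt}(C^{(1,w)})=\Sigma$. -/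

import Mathlib

open scoped ENNReal

noncomputable section

namespace WeightedCesaro

/-- A weight: a strictly positive sequence `w = (w(n))`, `n = 1, 2, 3, …`. -/
structure Weight where
  toFun : ℕ+ → ℝ
  pos' : ∀ n, 0 < toFun n

instance : CoeFun Weight (fun _ => ℕ+ → ℝ) := ⟨Weight.toFun⟩

theorem Weight.pos (w : Weight) (n : ℕ+) : 0 < w n := w.pos' n

/-- The weight is a bounded sequence. -/
def Weight.Bounded (w : Weight) : Prop := BddAbove (Set.range fun n => w n)

/-- The vector space `ℓ₁(w)` of all `x ∈ ℂ^ℕ` with `∑ w(n) |x_n| < ∞`. -/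
def ellOneSubmodule (w : Weight) : Submodule ℂ (ℕ+ → ℂ) where
  carrier := {x | Summable fun n => w n * ‖x n‖}
  zero_mem' := by simp [summable_zero]
  add_mem' := by
    intro x y hx hy
    refine Summable.of_nonneg_of_le (fun n => mul_nonneg (w.pos n).le (norm_nonneg _)) (fun n => ?_)
      (Summable.add hx hy)
    rw [← mul_add]
    exact mul_le_mul_of_nonneg_left (norm_add_le _ _) (w.pos n).le
  smul_mem' := by
    intro c x hx
    refine (Summable.mul_left ‖c‖ hx).congr (fun n => ?_)
    simp only [Pi.smul_apply, norm_smul]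
    ring

/-- `ℓ₁(w)` as a type of its own, so that it carries the weighted norm and not the topology of
coordinatewise convergence. -/
def EllOne (w : Weight) : Type := ellOneSubmodule w

namespace EllOne

variable {w : Weight}

instance : AddCommGroup (EllOne w) := inferInstanceAs (AddCommGroup (ellOneSubmodule w))

instance : Module ℂ (EllOne w) := inferInstanceAs (Module ℂ (ellOneSubmodule w))

instance : CoeFun (EllOne w) (fun _ => ℕ+ → ℂ) := ⟨fun x => x.1⟩

theorem ext {x y : EllOne w} (h : ∀ n, x n = y n) : x = y := Subtype.ext (funext h)

theorem summable (x : EllOne w) : Summable fun n => w n * ‖x n‖ := x.2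

theorem coe_add (x y : EllOne w) (n : ℕ+) : (x + y) n = x n + y n := rfl

theorem coe_sub (x y : EllOne w) (n : ℕ+) : (x - y) n = x n - y n := rfl

theorem coe_neg (x : EllOne w) (n : ℕ+) : (-x) n = -x n := rfl

theorem coe_zero (n : ℕ+) : (0 : EllOne w) n = 0 := rfl

theorem coe_smul (c : ℂ) (x : EllOne w) (n : ℕ+) : (c • x) n = c * x n := rfl

theorem term_nonneg (x : EllOne w) (n : ℕ+) : 0 ≤ w n * ‖x n‖ :=
  mul_nonneg (w.pos n).le (norm_nonneg _)

theorem term_le (x : EllOne w) (n : ℕ+) : w n * ‖x n‖ ≤ ∑' n, w n * ‖x n‖ :=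
  x.summable.le_tsum n (fun m _ => x.term_nonneg m)

/-- The norm `‖x‖_{1,w} = ∑ w(n) |x_n|`. -/
instance : NormedAddCommGroup (EllOne w) :=
  AddGroupNorm.toNormedAddCommGroup
    { toFun := fun x => ∑' n, w n * ‖x n‖
      map_zero' := by simp [coe_zero]
      add_le' := by
        intro x y
        rw [← x.summable.tsum_add y.summable]
        refine (x + y).summable.tsum_le_tsum (fun n => ?_) (x.summable.add y.summable)
        rw [← mul_add, coe_add]
        exact mul_le_mul_of_nonneg_left (norm_add_le _ _) (w.pos n).le
      neg' := by intro x; simp [coe_neg]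
      eq_zero_of_map_eq_zero' := by
        intro x hx
        refine ext fun n => ?_
        have h1 : w n * ‖x n‖ = 0 := le_antisymm (hx ▸ x.term_le n) (x.term_nonneg n)
        simpa [(w.pos n).ne', coe_zero] using h1 }

theorem norm_def (x : EllOne w) : ‖x‖ = ∑' n, w n * ‖x n‖ := rfl

instance : NormedSpace ℂ (EllOne w) where
  norm_smul_le c x := by
    rw [norm_def, norm_def, ← tsum_mul_left]
    refine le_of_eq (tsum_congr fun n => ?_)
    rw [coe_smul, norm_mul]
    ring

theorem weight_mul_norm_le (x : EllOne w) (n : ℕ+) : w n * ‖x n‖ ≤ ‖x‖ := x.term_le n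

/-- Convergence in `ℓ₁(w)` implies coordinatewise convergence. -/
theorem tendsto_apply {u : ℕ → EllOne w} {x : EllOne w}
    (h : Filter.Tendsto u Filter.atTop (nhds x)) (n : ℕ+) :
    Filter.Tendsto (fun k => u k n) Filter.atTop (nhds (x n)) := by
  rw [tendsto_iff_norm_sub_tendsto_zero] at h ⊢
  have h2 : Filter.Tendsto (fun k => (w n)⁻¹ * ‖u k - x‖) Filter.atTop (nhds 0) := by
    simpa using h.const_mul (w n)⁻¹
  refine squeeze_zero (fun k => norm_nonneg _) (fun k => ?_) h2
  have h3 := weight_mul_norm_le (u k - x) n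
  rw [coe_sub] at h3
  rw [inv_mul_eq_div, le_div_iff₀ (w.pos n), mul_comm]
  exact h3

/-- The multiplication operator `Φ_w x = (w(n) x_n)`, an isometric isomorphism onto `ℓ₁`. -/
def mulEquiv (w : Weight) : EllOne w ≃ₗᵢ[ℂ] lp (fun _ : ℕ+ => ℂ) 1 where
  toFun x := ⟨fun n => (w n : ℂ) * x n, by
    refine memℓp_gen (x.summable.congr fun n => ?_)
    simp [abs_of_pos (w.pos n)]⟩
  invFun y := ⟨fun n => (w n : ℂ)⁻¹ * y n, by
    have hy := (lp.memℓp y).summable (by simp)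
    refine hy.congr (fun n => ?_)
    have := (w.pos n).ne'
    simp [abs_of_pos (w.pos n)]
    field_simp⟩
  map_add' x y := by
    refine lp.ext (funext fun n => ?_)
    exact mul_add _ _ _
  map_smul' c x := by
    refine lp.ext (funext fun n => ?_)
    exact mul_left_comm _ _ _
  left_inv x := by
    refine ext fun n => ?_
    have : (w n : ℂ) ≠ 0 := by exact_mod_cast (w.pos n).ne'
    exact inv_mul_cancel_left₀ this _
  right_inv y := by
    refine lp.ext (funext fun n => ?_)
    have : (w n : ℂ) ≠ 0 := by exact_mod_cast (w.pos n).ne'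
    exact mul_inv_cancel_left₀ this _
  norm_map' x := by
    rw [lp.norm_eq_tsum_rpow (by simp), norm_def]
    simp only [ENNReal.toReal_one, Real.rpow_one, div_one]
    refine tsum_congr fun n => ?_
    change ‖(w n : ℂ) * x n‖ = w n * ‖x n‖
    simp [abs_of_pos (w.pos n)]

instance : CompleteSpace (EllOne w) :=
  (mulEquiv w).toIsometryEquiv.completeSpace

end EllOne

/-- The discrete Cesàro operator on `ℂ^ℕ`: `(C x)_n = (x_1 + ⋯ + x_n) / n`. -/
def cesaro : (ℕ+ → ℂ) →ₗ[ℂ] (ℕ+ → ℂ) where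
  toFun x n := (∑ k ∈ Finset.Icc 1 n, x k) / (n : ℂ)
  map_add' x y := by
    funext n
    simp [Finset.sum_add_distrib, add_div]
  map_smul' c x := by
    funext n
    simp [← Finset.mul_sum, mul_div_assoc]

theorem cesaro_apply (x : ℕ+ → ℂ) (n : ℕ+) :
    cesaro x n = (∑ k ∈ Finset.Icc 1 n, x k) / (n : ℂ) := rfl

/-- `C` acts in `ℓ₁(w)`: it maps `ℓ₁(w)` into itself. -/
def CesaroActs (w : Weight) : Prop :=
  ∀ x ∈ ellOneSubmodule w, cesaro x ∈ ellOneSubmodule w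

/-- The linear map that `C` induces on `ℓ₁(w)` when it acts there. -/
def cesaroLin (w : Weight) (h : CesaroActs w) : EllOne w →ₗ[ℂ] EllOne w :=
  cesaro.restrict h

theorem cesaroLin_apply (w : Weight) (h : CesaroActs w) (x : EllOne w) (n : ℕ+) :
    cesaroLin w h x n = cesaro x n := rfl

/-- Whenever `C` acts in `ℓ₁(w)`, it is continuous there (closed graph theorem). -/
theorem cesaroLin_continuous (w : Weight) (h : CesaroActs w) : Continuous (cesaroLin w h) := by
  refine (cesaroLin w h).continuous_of_seq_closed_graph fun u x y hu hTu => ?_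
  refine EllOne.ext fun n => ?_
  refine tendsto_nhds_unique (EllOne.tendsto_apply hTu n) ?_
  have h1 : Filter.Tendsto (fun k => (∑ j ∈ Finset.Icc 1 n, u k j) / (n : ℂ)) Filter.atTop
      (nhds ((∑ j ∈ Finset.Icc 1 n, x j) / (n : ℂ))) :=
    (tendsto_finsetSum _ fun j _ => EllOne.tendsto_apply hu j).div_const _
  exact h1

/-- The operator `C^{(1,w)} ∈ L(ℓ₁(w))`. -/
def cesaroOp (w : Weight) (h : CesaroActs w) : EllOne w →L[ℂ] EllOne w :=
  ⟨cesaroLin w h, cesaroLin_continuous w h⟩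

theorem cesaroOp_apply (w : Weight) (h : CesaroActs w) (x : EllOne w) (n : ℕ+) :
    cesaroOp w h x n = (∑ k ∈ Finset.Icc 1 n, x k) / (n : ℂ) := rfl

/-- The point spectrum: the set of all eigenvalues of an operator. -/
def pointSpectrum {E : Type*} [NormedAddCommGroup E] [NormedSpace ℂ E] (T : E →L[ℂ] E) : Set ℂ :=
  {μ | Module.End.HasEigenvalue (T : E →ₗ[ℂ] E) μ}

/-- `Σ = {1/m : m ∈ ℕ}`. -/
def sigmaSet : Set ℂ := {μ | ∃ m : ℕ+, μ = 1 / (m : ℂ)}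

/-- `Σ₀ = {0} ∪ Σ`. -/
def sigmaSet₀ : Set ℂ := {0} ∪ sigmaSet

/-- `R_w = {t ∈ ℝ : ∑ n^t w(n) < ∞}`. -/
def setR (w : Weight) : Set ℝ := {t | Summable fun n : ℕ+ => (n : ℝ) ^ t * w n}

/-- `t₀ = sup R_w`; meaningful when `R_w ≠ ℝ`. -/
def tZero (w : Weight) : ℝ := sSup (setR w)

/-- `sup_m (1 / (m^α w(m))) ∑_{n > m} w(n) / n^(1-α)`, as an element of `[0, ∞]`. -/
def resolventSup (w : Weight) (α : ℝ) : ℝ≥0∞ :=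
  ⨆ m : ℕ+, ENNReal.ofReal (1 / ((m : ℝ) ^ α * w m)) *
    ∑' n : Set.Ioi m, ENNReal.ofReal (w n / ((n : ℕ+) : ℝ) ^ (1 - α))

end WeightedCesaro

end

open WeightedCesaro

/-!
Solving `(λ - C) x = y` in `ℂ^ℕ` is a first-order recursion for the partial sums
`S_n = x_1 + ⋯ + x_n`: with `z = 1/λ` and `P_n = ∏_{k ≤ n} (1 - z/k)` it reads
`P_n S_n = P_{n-1} S_{n-1} + z P_{n-1} y_n`. For `λ ∉ Σ₀` no `P_n` vanishes, so there is exactly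
one solution (`sum_eq_solPartialSum`, `resolventSol_spec`). Euler's limit formula for `Γ(-z)` gives
`|P_n| ≍ n^{-α}` with `α = Re z` (`exists_bound_partialProd`), so off the diagonal the matrix
entries of the inverse have size `n^{α-1} m^{-α}` (`m < n`). A matrix acts boundedly on `ℓ₁(w)` when
the norms of its columns are at most a constant times `w(m)`, and this is the supremum condition.
In one direction the order of summation in the dominating double series is interchanged
(`tsum_mul_sum_Icc_ne_top`) and the open mapping theorem gives continuity of the inverse; in the
other the resolvent is applied to the unit vectors.

For `λ = 1/m` the same triangular structure shows that `e_m` is not in the range of `λ - C`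
(`one_div_mem_spectrum`), and that an eigenvector with first nonzero coordinate `m` is a multiple
of `n ↦ binom(n-1, m-1)` (`eigen_eq_binomSeq`). This sequence grows like `n^{m-1}`, so it lies in
`ℓ₁(w)` exactly when `m - 1 ∈ R_w` (`binomSeq_mem_iff`).
-/

noncomputable section

namespace WeightedCesaro

open Filter Topology

/-! ### Sums and products over initial segments -/

theorem sum_Icc_one_add_one (f : ℕ+ → ℂ) (n : ℕ+) :
    ∑ k ∈ Finset.Icc 1 (n + 1), f k = ∑ k ∈ Finset.Icc 1 n, f k + f (n + 1) := by
  have h : Finset.Icc 1 (n + 1) = insert (n + 1) (Finset.Icc 1 n) := by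
    ext k
    simp only [Finset.mem_Icc, Finset.mem_insert, ← PNat.coe_le_coe, ← PNat.coe_inj,
      PNat.add_coe, PNat.one_coe]
    have := k.pos
    omega
  rw [h, Finset.sum_insert (by simp), add_comm]

/-- The partial product `∏_{k=1}^n (1 - z/k)`. -/
def partialProd (z : ℂ) (n : ℕ) : ℂ := ∏ k ∈ Finset.range n, (1 - z / ((k : ℂ) + 1))

theorem partialProd_succ (z : ℂ) (n : ℕ) :
    partialProd z (n + 1) = partialProd z n * (1 - z / ((n : ℂ) + 1)) :=
  Finset.prod_range_succ _ _

theorem one_sub_div_ne_zero {z : ℂ} (hz : ∀ m : ℕ, z ≠ m) (n : ℕ) :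
    1 - z / ((n : ℂ) + 1) ≠ 0 := by
  have h0 : (n : ℂ) + 1 ≠ 0 := Nat.cast_add_one_ne_zero n
  intro h
  rw [sub_eq_zero, eq_div_iff h0, one_mul] at h
  exact hz (n + 1) (by rw [← h]; push_cast; ring)

theorem partialProd_ne_zero {z : ℂ} (hz : ∀ m : ℕ, z ≠ m) (n : ℕ) : partialProd z n ≠ 0 :=
  Finset.prod_ne_zero_iff.mpr fun k _ => one_sub_div_ne_zero hz k

/-- Euler's limit formula for `Γ(-z)` determines the growth of the partial products. -/
theorem tendsto_rpow_mul_norm_partialProd {z : ℂ} (hz : ∀ m : ℕ, z ≠ m) :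
    ∃ L : ℝ, 0 < L ∧
      Tendsto (fun n : ℕ => (n : ℝ) ^ z.re * ‖partialProd z n‖) atTop (𝓝 L) := by
  have hz0 : z ≠ 0 := by simpa using hz 0
  have hG : Complex.Gamma (-z) ≠ 0 :=
    Complex.Gamma_ne_zero fun m h => hz m (neg_injective h)
  have hden : ∀ n : ℕ, ∏ j ∈ Finset.range (n + 1), (-z + (j : ℂ)) =
      -z * (n.factorial * partialProd z n) := by
    intro n
    induction n with
    | zero => simp [partialProd]
    | succ n ih =>
      have h0 : (n : ℂ) + 1 ≠ 0 := Nat.cast_add_one_ne_zero n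
      rw [Finset.prod_range_succ, ih, partialProd_succ, Nat.factorial_succ]
      push_cast
      field_simp
      ring
  have h1 := ((Complex.GammaSeq_tendsto_Gamma (-z)).norm.inv₀ (norm_ne_zero_iff.mpr hG)).const_mul
    ‖z‖⁻¹
  refine ⟨_, by positivity, h1.congr' ?_⟩
  filter_upwards [eventually_gt_atTop 0] with n hn
  have hn' : (0 : ℝ) < n := by exact_mod_cast hn
  have hf : (n.factorial : ℝ) ≠ 0 := by exact_mod_cast n.factorial_ne_zero
  have hp : ‖partialProd z n‖ ≠ 0 := norm_ne_zero_iff.mpr (partialProd_ne_zero hz n)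
  have hzn : ‖z‖ ≠ 0 := norm_ne_zero_iff.mpr hz0
  have hr : (n : ℝ) ^ z.re ≠ 0 := (Real.rpow_pos_of_pos hn' _).ne'
  rw [Complex.GammaSeq, hden, norm_div, norm_mul, norm_mul, norm_mul, norm_neg,
    Complex.norm_natCast, ← Complex.ofReal_natCast n, Complex.norm_cpow_eq_rpow_re_of_pos hn',
    Complex.neg_re, Real.rpow_neg hn'.le]
  field_simp

/-- A sequence that is positive from index `1` on and has a positive limit is bounded and bounded
away from zero. -/
theorem exists_bound_of_tendsto_pos {f : ℕ → ℝ} {L : ℝ} (hL : 0 < L)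
    (hf : Tendsto f atTop (𝓝 L)) (hpos : ∀ n, 0 < n → 0 < f n) :
    ∃ A : ℝ, 0 < A ∧ ∀ n, 0 < n → f n ≤ A ∧ 1 ≤ A * f n := by
  obtain ⟨a, ha⟩ := hf.bddAbove_range
  obtain ⟨b, hb⟩ := (hf.inv₀ hL.ne').bddAbove_range
  refine ⟨max 1 (max a b), by positivity, fun n hn => ⟨?_, ?_⟩⟩
  · exact (ha ⟨n, rfl⟩).trans ((le_max_left _ _).trans (le_max_right _ _))
  · have h := (hb ⟨n, rfl⟩).trans ((le_max_right a b).trans (le_max_right 1 _))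
    simp only at h
    rwa [inv_eq_one_div, div_le_iff₀ (hpos n hn)] at h

/-- The two-sided estimate `|∏_{k ≤ n} (1 - z/k)| ≍ n^{-Re z}`, also for the product with one
factor less. -/
theorem exists_bound_partialProd {z : ℂ} (hz : ∀ m : ℕ, z ≠ m) :
    ∃ A : ℝ, 0 < A ∧ ∀ n : ℕ+,
      ((n : ℝ) ^ z.re * ‖partialProd z n‖ ≤ A ∧ 1 ≤ A * ((n : ℝ) ^ z.re * ‖partialProd z n‖)) ∧
      ((n : ℝ) ^ z.re * ‖partialProd z n.natPred‖ ≤ A ∧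
        1 ≤ A * ((n : ℝ) ^ z.re * ‖partialProd z n.natPred‖)) := by
  obtain ⟨L, hL, hlim⟩ := tendsto_rpow_mul_norm_partialProd hz
  have hpos : ∀ n m : ℕ, 0 < n → 0 < (n : ℝ) ^ z.re * ‖partialProd z m‖ := by
    intro n m hn
    have : (0 : ℝ) < n := by exact_mod_cast hn
    exact mul_pos (Real.rpow_pos_of_pos this _) (norm_pos_iff.mpr (partialProd_ne_zero hz m))
  have hlim' : Tendsto (fun n : ℕ => (n : ℝ) ^ z.re * ‖partialProd z (n - 1)‖) atTop (𝓝 L) := by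
    have h1 : Tendsto (fun n : ℕ => ‖1 - z / (n : ℂ)‖) atTop (𝓝 1) := by
      simpa using ((tendsto_const_div_atTop_nhds_zero_nat z).const_sub 1).norm
    have h2 := hlim.div h1 one_ne_zero
    rw [div_one] at h2
    refine h2.congr' ?_
    filter_upwards [eventually_gt_atTop 0] with n hn
    obtain ⟨k, rfl⟩ := Nat.exists_eq_add_one_of_ne_zero hn.ne'
    have h3 : ‖1 - z / ((k + 1 : ℕ) : ℂ)‖ ≠ 0 := by
      push_cast
      exact norm_ne_zero_iff.mpr (one_sub_div_ne_zero hz k)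
    rw [Pi.div_apply, div_eq_iff h3, partialProd_succ, norm_mul]
    push_cast
    rw [mul_assoc]
  obtain ⟨A, hA, h1⟩ := exists_bound_of_tendsto_pos hL hlim fun n hn => hpos n n hn
  obtain ⟨B, hB, h2⟩ := exists_bound_of_tendsto_pos hL hlim' fun n hn => hpos n _ hn
  refine ⟨max A B, by positivity, fun n => ⟨⟨?_, ?_⟩, ?_, ?_⟩⟩
  · exact (h1 n n.pos).1.trans (le_max_left _ _)
  · exact (h1 n n.pos).2.trans
      (mul_le_mul_of_nonneg_right (le_max_left _ _) (hpos n n n.pos).le)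
  · exact (h2 n n.pos).1.trans (le_max_right _ _)
  · exact (h2 n n.pos).2.trans
      (mul_le_mul_of_nonneg_right (le_max_right _ _) (hpos n _ n.pos).le)

/-! ### The resolvent equation on arbitrary sequences -/

/-- The partial sums `x_1 + ⋯ + x_n` of the solution `x` of `(λ - C) x = y`, where `z = 1/λ`. -/
def solPartialSum (z : ℂ) (y : ℕ+ → ℂ) (n : ℕ+) : ℂ :=
  (partialProd z n)⁻¹ * (z * ∑ k ∈ Finset.Icc 1 n, partialProd z k.natPred * y k)

theorem solPartialSum_one {z : ℂ} (y : ℕ+ → ℂ) :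
    solPartialSum z y 1 = (1 - z)⁻¹ * (z * y 1) := by
  have h : (1 : ℕ+).natPred = 0 := rfl
  simp [solPartialSum, partialProd, h]

theorem solPartialSum_add_one {z : ℂ} (hz : ∀ m : ℕ, z ≠ m) (y : ℕ+ → ℂ) (n : ℕ+) :
    solPartialSum z y (n + 1) =
      (1 - z / ((n : ℂ) + 1))⁻¹ * (solPartialSum z y n + z * y (n + 1)) := by
  have h1 := partialProd_ne_zero hz n
  have h2 := one_sub_div_ne_zero hz n
  have h3 : (n + 1).natPred = (n : ℕ) := rfl
  rw [solPartialSum, solPartialSum, sum_Icc_one_add_one, h3, PNat.add_coe, PNat.one_coe,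
    partialProd_succ, mul_inv]
  field_simp

/-- A solution of `(λ - C) x = y` is unique: its partial sums are determined by `y`. -/
theorem sum_eq_solPartialSum {z : ℂ} (hz : ∀ m : ℕ, z ≠ m) {x y : ℕ+ → ℂ}
    (h : ∀ n, z⁻¹ * x n - (∑ k ∈ Finset.Icc 1 n, x k) / (n : ℂ) = y n) (n : ℕ+) :
    ∑ k ∈ Finset.Icc 1 n, x k = solPartialSum z y n := by
  have hz0 : z ≠ 0 := by simpa using hz 0
  have hx : ∀ n, x n - z / (n : ℂ) * ∑ k ∈ Finset.Icc 1 n, x k = z * y n := by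
    intro n
    rw [← h n]
    field_simp
  induction n using PNat.recOn with
  | one =>
    have h1 := one_sub_div_ne_zero hz 0
    have h2 := hx 1
    simp only [Finset.Icc_self, Finset.sum_singleton, PNat.one_coe, Nat.cast_one, div_one] at h2 ⊢
    rw [solPartialSum_one, ← h2]
    simp only [Nat.cast_zero, zero_add, div_one] at h1
    field_simp
  | succ n ih =>
    have h1 := one_sub_div_ne_zero hz n
    have h2 := hx (n + 1)
    rw [solPartialSum_add_one hz, ← ih, eq_inv_mul_iff_mul_eq₀ h1, ← h2]
    rw [sum_Icc_one_add_one]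
    push_cast
    ring

/-- The solution `x` of `(λ - C) x = y`, where `z = 1/λ`. -/
def resolventSol (z : ℂ) (y : ℕ+ → ℂ) (n : ℕ+) : ℂ := z * (y n + solPartialSum z y n / (n : ℂ))

theorem sum_resolventSol {z : ℂ} (hz : ∀ m : ℕ, z ≠ m) (y : ℕ+ → ℂ) (n : ℕ+) :
    ∑ k ∈ Finset.Icc 1 n, resolventSol z y k = solPartialSum z y n := by
  induction n using PNat.recOn with
  | one =>
    have h1 := one_sub_div_ne_zero hz 0
    simp only [Nat.cast_zero, zero_add, div_one] at h1
    simp only [Finset.Icc_self, Finset.sum_singleton, resolventSol, solPartialSum_one,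
      PNat.one_coe, Nat.cast_one, div_one]
    field_simp
    ring
  | succ n ih =>
    have h1 := one_sub_div_ne_zero hz n
    have h2 := solPartialSum_add_one hz y n
    rw [eq_inv_mul_iff_mul_eq₀ h1] at h2
    rw [sum_Icc_one_add_one, ih, resolventSol]
    push_cast
    linear_combination -h2

theorem resolventSol_spec {z : ℂ} (hz : ∀ m : ℕ, z ≠ m) (y : ℕ+ → ℂ) (n : ℕ+) :
    z⁻¹ * resolventSol z y n - (∑ k ∈ Finset.Icc 1 n, resolventSol z y k) / (n : ℂ) = y n := by
  have hz0 : z ≠ 0 := by simpa using hz 0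
  rw [sum_resolventSol hz, resolventSol, inv_mul_cancel_left₀ hz0]
  ring

/-! ### Eigenvectors -/

/-- The sequence `n ↦ binom(n-1, m-1)`, which spans the eigenspace of `C` for `1/m`. -/
def binomSeq (m n : ℕ+) : ℂ := (n.natPred.choose m.natPred : ℂ)

theorem sum_binomSeq (m n : ℕ+) :
    ∑ k ∈ Finset.Icc 1 n, binomSeq m k = ((n : ℕ).choose m : ℂ) := by
  have hm := m.natPred_add_one
  induction n using PNat.recOn with
  | one =>
    simp only [Finset.Icc_self, Finset.sum_singleton, binomSeq]
    rw [← hm]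
    have : (1 : ℕ+).natPred = 0 := rfl
    rw [this, PNat.one_coe, Nat.choose_succ_succ]
    simp [Nat.choose_eq_zero_of_lt m.pos]
  | succ n ih =>
    rw [sum_Icc_one_add_one, ih, binomSeq, PNat.add_coe, PNat.one_coe, ← hm,
      Nat.choose_succ_succ, add_comm]
    push_cast
    rfl

theorem cesaro_binomSeq (m n : ℕ+) :
    (∑ k ∈ Finset.Icc 1 n, binomSeq m k) / (n : ℂ) = 1 / (m : ℂ) * binomSeq m n := by
  have hn : (n : ℂ) ≠ 0 := by exact_mod_cast n.ne_zero
  have hm : (m : ℂ) ≠ 0 := by exact_mod_cast m.ne_zero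
  have h := Nat.add_one_mul_choose_eq n.natPred m.natPred
  rw [n.natPred_add_one, m.natPred_add_one] at h
  have h' : (n : ℂ) * (n.natPred.choose m.natPred : ℂ) = ((n : ℕ).choose m : ℂ) * (m : ℂ) := by
    exact_mod_cast h
  rw [sum_binomSeq, binomSeq]
  field_simp
  linear_combination -h'

theorem sum_Icc_eq_single {x : ℕ+ → ℂ} {m : ℕ+} (h : ∀ k < m, x k = 0) :
    ∑ k ∈ Finset.Icc 1 m, x k = x m := by
  refine Finset.sum_eq_single_of_mem m (by simp) fun k hk hkm => ?_
  exact h k (lt_of_le_of_ne (Finset.mem_Icc.mp hk).2 hkm)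

/-- An eigenvector of `C` on `ℂ^ℕ` whose first nonzero coordinate has index `m` belongs to the
eigenvalue `1/m` and is a multiple of `binomSeq m`. -/
theorem eigen_eq_binomSeq {x : ℕ+ → ℂ} {μ : ℂ} {m : ℕ+}
    (hx : ∀ n : ℕ+, (∑ k ∈ Finset.Icc 1 n, x k) / (n : ℂ) = μ * x n)
    (hm : x m ≠ 0) (hlt : ∀ k < m, x k = 0) :
    μ = 1 / (m : ℂ) ∧ ∀ n, x n = x m * binomSeq m n := by
  have hm0 : (m : ℂ) ≠ 0 := by exact_mod_cast m.ne_zero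
  have hμ : μ = 1 / (m : ℂ) := by
    have h := hx m
    rw [sum_Icc_eq_single hlt] at h
    refine mul_right_cancel₀ hm ?_
    rw [← h]
    ring
  refine ⟨hμ, fun n => ?_⟩
  have hrec : ∀ n : ℕ+, ((n : ℂ) + 1 - m) * x (n + 1) = n * x n := by
    intro n
    have hn : (n : ℂ) ≠ 0 := by exact_mod_cast n.ne_zero
    have hn1 : (n : ℂ) + 1 ≠ 0 := by exact_mod_cast (n + 1).ne_zero
    have h1 := hx n
    have h2 := hx (n + 1)
    rw [div_eq_iff hn, hμ] at h1
    rw [sum_Icc_one_add_one, h1, hμ] at h2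
    push_cast at h2
    field_simp at h2
    linear_combination -h2
  have hbrec : ∀ n : ℕ+, ((n : ℂ) + 1 - m) * binomSeq m (n + 1) = n * binomSeq m n := by
    intro n
    have hn : (n : ℂ) ≠ 0 := by exact_mod_cast n.ne_zero
    have hn1 : (n : ℂ) + 1 ≠ 0 := by exact_mod_cast (n + 1).ne_zero
    have h1 := cesaro_binomSeq m n
    have h2 := cesaro_binomSeq m (n + 1)
    rw [div_eq_iff hn] at h1
    rw [sum_Icc_one_add_one, h1] at h2
    push_cast at h2
    field_simp at h2
    linear_combination -h2
  have hbself : binomSeq m m = 1 := by simp [binomSeq]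
  have hblt : ∀ k < m, binomSeq m k = 0 := by
    intro k hk
    have : k.natPred < m.natPred := PNat.natPred_lt_natPred.mpr hk
    simp [binomSeq, Nat.choose_eq_zero_of_lt this]
  induction n using PNat.recOn with
  | one =>
    rcases (one_le : 1 ≤ m).lt_or_eq with h | h
    · rw [hlt 1 h, hblt 1 h, mul_zero]
    · rw [h, hbself, mul_one]
  | succ n ih =>
    rcases lt_trichotomy (n + 1) m with h | h | h
    · rw [hlt _ h, hblt _ h, mul_zero]
    · rw [h, hbself, mul_one]
    · have hne : (n : ℂ) + 1 - m ≠ 0 := by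
        rw [sub_ne_zero]
        have : (m : ℕ) < (n + 1 : ℕ+) := h
        rw [PNat.add_coe, PNat.one_coe] at this
        exact_mod_cast this.ne'
      refine mul_left_cancel₀ hne ?_
      rw [hrec, ih]
      linear_combination -(x m) * hbrec n

/-! ### The Cesàro operator on the weighted space -/

theorem algebraMap_sub_cesaroOp_apply (w : Weight) (hC : CesaroActs w) (l : ℂ) (x : EllOne w)
    (n : ℕ+) : (algebraMap ℂ (EllOne w →L[ℂ] EllOne w) l - cesaroOp w hC) x n =
      l * x n - (∑ k ∈ Finset.Icc 1 n, x k) / (n : ℂ) := rfl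

theorem mem_resolventSet_iff_bijective (w : Weight) (hC : CesaroActs w) (l : ℂ) :
    l ∈ resolventSet ℂ (cesaroOp w hC) ↔
      Function.Bijective (algebraMap ℂ (EllOne w →L[ℂ] EllOne w) l - cesaroOp w hC) :=
  ContinuousLinearMap.isUnit_iff_bijective

/-- The unit vector `e_m` of `ℓ₁(w)`. -/
def unitVec (w : Weight) (m : ℕ+) : EllOne w :=
  ⟨Pi.single m 1, summable_of_ne_finset_zero (s := {m}) fun n hn => by
    rw [Finset.mem_singleton] at hn
    simp [hn]⟩

theorem unitVec_apply (w : Weight) (m n : ℕ+) :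
    unitVec w m n = (Pi.single m 1 : ℕ+ → ℂ) n := rfl

theorem norm_unitVec (w : Weight) (m : ℕ+) : ‖unitVec w m‖ = w m := by
  rw [EllOne.norm_def, tsum_eq_single m fun n hn => by simp [unitVec_apply, hn]]
  simp [unitVec_apply]

/-- If `x / m - C x` vanishes before the index `m`, then so does `x`, and hence the coordinate `m`
of `x / m - C x` vanishes as well; in particular `e_m` is not in the range of `1/m - C`. -/
theorem one_div_mem_spectrum (w : Weight) (hC : CesaroActs w) (m : ℕ+) :
    (1 / (m : ℂ)) ∈ spectrum ℂ (cesaroOp w hC) := by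
  intro h
  obtain ⟨x, hx⟩ := ((mem_resolventSet_iff_bijective w hC _).mp h).2 (unitVec w m)
  have hx' : ∀ n : ℕ+, 1 / (m : ℂ) * x n - (∑ k ∈ Finset.Icc 1 n, x k) / (n : ℂ) =
      (Pi.single m 1 : ℕ+ → ℂ) n := by
    intro n
    rw [← algebraMap_sub_cesaroOp_apply w hC, hx, unitVec_apply]
  have hm : (m : ℂ) ≠ 0 := by exact_mod_cast m.ne_zero
  have hz : ∀ n, n < m → x n = 0 := by
    intro n
    induction n using PNat.strongInductionOn with
    | _ n ih =>
      intro hnm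
      have h1 := hx' n
      rw [sum_Icc_eq_single fun k hk => ih k hk (hk.trans hnm), Pi.single_eq_of_ne hnm.ne] at h1
      have hn : (n : ℂ) ≠ 0 := by exact_mod_cast n.ne_zero
      have hne : (n : ℂ) - m ≠ 0 := by
        rw [sub_ne_zero]
        exact_mod_cast (PNat.coe_injective.ne hnm.ne)
      field_simp at h1
      have h2 : ((n : ℂ) - m) * x n = 0 := by linear_combination h1
      exact (mul_eq_zero.mp h2).resolve_left hne
  have h1 := hx' m
  rw [sum_Icc_eq_single hz, Pi.single_eq_same] at h1
  have : (0 : ℂ) = 1 := by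
    rw [← h1]
    ring
  exact zero_ne_one this

/-- The point `0` lies in the spectrum because the spectrum is closed and contains every `1/m`. -/
theorem sigmaSet₀_subset_spectrum (w : Weight) (hC : CesaroActs w) :
    sigmaSet₀ ⊆ spectrum ℂ (cesaroOp w hC) := by
  rintro l (rfl | ⟨m, rfl⟩)
  · refine (spectrum.isClosed (𝕜 := ℂ) (cesaroOp w hC)).mem_of_tendsto
      (tendsto_one_div_add_atTop_nhds_zero_nat (𝕜 := ℂ)) (Eventually.of_forall fun n => ?_)
    have := one_div_mem_spectrum w hC n.succPNat
    simpa using this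
  · exact one_div_mem_spectrum w hC m

theorem one_div_ne_natCast {l : ℂ} (hl : l ∉ sigmaSet₀) (m : ℕ) : 1 / l ≠ m := by
  intro h
  apply hl
  rcases Nat.eq_zero_or_pos m with rfl | hm
  · left
    simpa using h
  · right
    refine ⟨⟨m, hm⟩, ?_⟩
    change l = 1 / (m : ℂ)
    rw [← h, one_div_one_div]

/-! ### The resolvent set -/

theorem exists_norm_solPartialSum_div_le {z : ℂ} (hz : ∀ m : ℕ, z ≠ m) :
    ∃ K : ℝ, ∀ (y : ℕ+ → ℂ) (n : ℕ+), ‖solPartialSum z y n / (n : ℂ)‖ ≤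
      K * (1 / (n : ℝ) ^ (1 - z.re) * ∑ k ∈ Finset.Icc 1 n, ‖y k‖ / (k : ℝ) ^ z.re) := by
  obtain ⟨A, hA, hP⟩ := exists_bound_partialProd hz
  refine ⟨A * A * ‖z‖, fun y n => ?_⟩
  have hn : (0 : ℝ) < n := by exact_mod_cast n.pos
  have hr := Real.rpow_pos_of_pos hn z.re
  have hp : 0 < ‖partialProd z n‖ := norm_pos_iff.mpr (partialProd_ne_zero hz n)
  have h1 : ‖partialProd z n‖⁻¹ ≤ A * (n : ℝ) ^ z.re := by
    rw [inv_eq_one_div, div_le_iff₀ hp, mul_assoc]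
    exact (hP n).1.2
  have h2 : ‖∑ k ∈ Finset.Icc 1 n, partialProd z k.natPred * y k‖ ≤
      A * ∑ k ∈ Finset.Icc 1 n, ‖y k‖ / (k : ℝ) ^ z.re := by
    rw [Finset.mul_sum]
    refine norm_sum_le_of_le _ fun k _ => ?_
    have hk : (0 : ℝ) < k := by exact_mod_cast k.pos
    have hrk := Real.rpow_pos_of_pos hk z.re
    rw [norm_mul, mul_div_assoc', le_div_iff₀ hrk]
    calc _ = (k : ℝ) ^ z.re * ‖partialProd z k.natPred‖ * ‖y k‖ := by ring
      _ ≤ _ := mul_le_mul_of_nonneg_right (hP k).2.1 (norm_nonneg _)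
  rw [norm_div, solPartialSum, norm_mul, norm_mul, norm_inv, Complex.norm_natCast,
    Real.rpow_sub hn, Real.rpow_one, div_le_iff₀ hn]
  calc _ ≤ (A * (n : ℝ) ^ z.re) *
        (‖z‖ * (A * ∑ k ∈ Finset.Icc 1 n, ‖y k‖ / (k : ℝ) ^ z.re)) := by gcongr
    _ = _ := by
      field_simp

/-- The tail `∑_{n > m} w(n) / n^{1-α}`. -/
def tailSum (w : Weight) (α : ℝ) (m : ℕ+) : ℝ≥0∞ :=
  ∑' n : Set.Ioi m, ENNReal.ofReal (w n / ((n : ℕ+) : ℝ) ^ (1 - α))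

/-- Interchanging the order of summation bounds the double sum that dominates the resolvent. -/
theorem tsum_mul_sum_Icc_ne_top (w : Weight) {α : ℝ} (h : resolventSup w α < ⊤) (y : EllOne w) :
    ∑' n : ℕ+, ENNReal.ofReal
      (w n / (n : ℝ) ^ (1 - α) * ∑ k ∈ Finset.Icc 1 n, ‖y k‖ / (k : ℝ) ^ α) ≠ ⊤ := by
  set g : ℕ+ → ℝ≥0∞ := fun n => ENNReal.ofReal (w n / (n : ℝ) ^ (1 - α)) with hg
  set u : ℕ+ → ℝ≥0∞ := fun k => ENNReal.ofReal (‖y k‖ / (k : ℝ) ^ α) with hu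
  have hr : ∀ (n : ℕ+) (s : ℝ), 0 < (n : ℝ) ^ s := fun n s =>
    Real.rpow_pos_of_pos (by exact_mod_cast n.pos) s
  have hun : ∀ k, 0 ≤ ‖y k‖ / (k : ℝ) ^ α := fun k => div_nonneg (norm_nonneg _) (hr k α).le
  have h1 : ∀ n : ℕ+, ENNReal.ofReal
      (w n / (n : ℝ) ^ (1 - α) * ∑ k ∈ Finset.Icc 1 n, ‖y k‖ / (k : ℝ) ^ α) =
        ∑' k, (Set.Iic n).indicator (fun k => g n * u k) k := by
    intro n
    rw [ENNReal.ofReal_mul (div_nonneg (w.pos n).le (hr n _).le),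
      ENNReal.ofReal_sum_of_nonneg fun k _ => hun k, Finset.mul_sum]
    have hs : (Set.Iic n) = ((Finset.Icc 1 n : Finset ℕ+) : Set ℕ+) := by
      ext k
      simp
    rw [hs, ← tsum_subtype, Finset.tsum_subtype' (Finset.Icc 1 n) fun k => g n * u k]
  have h2 : ∀ k : ℕ+, ∑' n, (Set.Iic n).indicator (fun k => g n * u k) k =
      (g k + tailSum w α k) * u k := by
    intro k
    have h3 : ∀ n, (Set.Iic n).indicator (fun k => g n * u k) k =
        ((if n = k then g k else 0) + (Set.Ioi k).indicator g n) * u k := by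
      intro n
      rcases lt_trichotomy n k with hnk | rfl | hnk
      · simp [Set.indicator, hnk.not_ge, hnk.ne, hnk.not_gt]
      · simp [Set.indicator]
      · simp [Set.indicator, hnk.le, hnk.ne', hnk]
    rw [tsum_congr h3, ENNReal.tsum_mul_right, ENNReal.tsum_add, tsum_ite_eq, tailSum,
      ← tsum_subtype (Set.Ioi k) g]
  rw [tsum_congr h1, ENNReal.tsum_comm, tsum_congr h2]
  have h4 : ∀ k, (g k + tailSum w α k) * u k ≤
      (1 + resolventSup w α) * ENNReal.ofReal (w k * ‖y k‖) := by
    intro k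
    have hk1 : (1 : ℝ) ≤ k := by exact_mod_cast k.pos
    have hk : (0 : ℝ) < k := by exact_mod_cast k.pos
    rw [add_mul, add_mul, one_mul]
    refine add_le_add ?_ ?_
    · rw [hg, hu]
      simp only
      rw [← ENNReal.ofReal_mul (div_nonneg (w.pos k).le (hr k _).le)]
      refine ENNReal.ofReal_le_ofReal ?_
      rw [div_mul_div_comm, ← Real.rpow_add hk, sub_add_cancel, Real.rpow_one]
      exact div_le_self (y.term_nonneg k) hk1
    · have h5 : u k = ENNReal.ofReal (1 / ((k : ℝ) ^ α * w k)) *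
          ENNReal.ofReal (w k * ‖y k‖) := by
        have hwk := w.pos k
        have hrk := hr k α
        rw [← ENNReal.ofReal_mul (by positivity)]
        rw [hu]
        field_simp
      rw [h5, ← mul_assoc, mul_comm (tailSum w α k)]
      exact mul_le_mul_left (le_iSup (fun m : ℕ+ => ENNReal.ofReal (1 / ((m : ℝ) ^ α * w m)) *
        tailSum w α m) k) _
  refine ne_top_of_le_ne_top ?_ (ENNReal.tsum_le_tsum h4)
  rw [ENNReal.tsum_mul_left, ← ENNReal.ofReal_tsum_of_nonneg y.term_nonneg y.summable]
  exact ENNReal.mul_ne_top (ENNReal.add_ne_top.mpr ⟨ENNReal.one_ne_top, h.ne⟩)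
    ENNReal.ofReal_ne_top

theorem resolventSol_mem (w : Weight) {z : ℂ} (hz : ∀ m : ℕ, z ≠ m)
    (h : resolventSup w z.re < ⊤) (y : EllOne w) : resolventSol z y ∈ ellOneSubmodule w := by
  obtain ⟨K, hK⟩ := exists_norm_solPartialSum_div_le hz
  have hs := ENNReal.summable_toReal (tsum_mul_sum_Icc_ne_top w h y)
  have hr : ∀ (n : ℕ+) (s : ℝ), 0 ≤ (n : ℝ) ^ s := fun n s =>
    Real.rpow_nonneg (by exact_mod_cast n.pos.le) s
  refine Submodule.smul_mem _ z (Submodule.add_mem _ y.2 (?_ :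
    (fun n : ℕ+ => solPartialSum z y n / (n : ℂ)) ∈ ellOneSubmodule w))
  refine Summable.of_nonneg_of_le (fun n => mul_nonneg (w.pos n).le (norm_nonneg _))
    (fun n => ?_) (hs.mul_left K)
  rw [ENNReal.toReal_ofReal (mul_nonneg (div_nonneg (w.pos n).le (hr n _))
    (Finset.sum_nonneg fun k _ => div_nonneg (norm_nonneg _) (hr k _)))]
  refine (mul_le_mul_of_nonneg_left (hK y n)
    (w.pos n).le).trans_eq ?_
  ring

theorem mem_resolventSet_of_resolventSup_lt_top (w : Weight) (hC : CesaroActs w) {l : ℂ}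
    (hl : l ∉ sigmaSet₀) (h : resolventSup w (1 / l).re < ⊤) :
    l ∈ resolventSet ℂ (cesaroOp w hC) := by
  have hz := one_div_ne_natCast hl
  have hl' : l = (1 / l)⁻¹ := by simp
  have hl0 : l ≠ 0 := fun h0 => hl (Or.inl h0)
  -- By the open mapping theorem only bijectivity of `l - C` is needed, not a bound on the inverse.
  rw [mem_resolventSet_iff_bijective]
  refine ⟨(injective_iff_map_eq_zero _).mpr fun x hx => ?_, fun y => ?_⟩
  · have h0 : ∀ n : ℕ+, (1 / l)⁻¹ * x n - (∑ k ∈ Finset.Icc 1 n, x k) / (n : ℂ) =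
        (0 : ℕ+ → ℂ) n := by
      intro n
      rw [← hl', ← algebraMap_sub_cesaroOp_apply w hC, hx]
      rfl
    refine EllOne.ext fun n => ?_
    have h1 := h0 n
    rw [sum_eq_solPartialSum hz h0 n, ← hl'] at h1
    rw [EllOne.coe_zero]
    simpa [solPartialSum, hl0] using h1
  · refine ⟨⟨resolventSol (1 / l) y, resolventSol_mem w hz h y⟩, EllOne.ext fun n => ?_⟩
    change l * resolventSol (1 / l) y n -
      (∑ k ∈ Finset.Icc 1 n, resolventSol (1 / l) y k) / (n : ℂ) = y n
    have h1 := resolventSol_spec hz y n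
    rwa [← hl'] at h1

/-- With `α = Re(1/l)`, the coordinates of the resolvent applied to `e_m` have modulus comparable
with `n^{α-1} m^{-α}` for `n > m`, so the tail sum at `m` is controlled by
`‖R e_m‖ ≤ ‖R‖ w(m)`. -/
theorem resolventSup_lt_top_of_mem_resolventSet (w : Weight) (hC : CesaroActs w) {l : ℂ}
    (hl : l ∉ sigmaSet₀) (h : l ∈ resolventSet ℂ (cesaroOp w hC)) :
    resolventSup w (1 / l).re < ⊤ := by
  have hz := one_div_ne_natCast hl
  have hl' : l = (1 / l)⁻¹ := by simp
  have hl0 : l ≠ 0 := fun h0 => hl (Or.inl h0)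
  obtain ⟨A, hA, hP⟩ := exists_bound_partialProd hz
  obtain ⟨u, hu⟩ := h
  set R : EllOne w →L[ℂ] EllOne w := ↑u⁻¹ with hR
  set z := 1 / l
  have hz0 : 0 < ‖z‖ := norm_pos_iff.mpr (one_div_ne_zero hl0)
  clear_value z
  refine (iSup_le fun m => ?_ : resolventSup w z.re ≤
    ENNReal.ofReal (A * A * (‖z‖⁻¹ * ‖z‖⁻¹) * ‖R‖)).trans_lt ENNReal.ofReal_lt_top
  set x : EllOne w := R (unitVec w m)
  have hx : ∀ n : ℕ+, z⁻¹ * x n - (∑ k ∈ Finset.Icc 1 n, x k) / (n : ℂ) =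
      (Pi.single m 1 : ℕ+ → ℂ) n := by
    intro n
    rw [← hl', ← algebraMap_sub_cesaroOp_apply w hC, ← hu, ← unitVec_apply w]
    have h1 : ((u : EllOne w →L[ℂ] EllOne w) * R) (unitVec w m) = unitVec w m := by
      rw [hR, Units.mul_inv]
      rfl
    exact congrArg (fun v : EllOne w => v n) h1
  have hxn : ∀ n : Set.Ioi m, w n / ((n : ℕ+) : ℝ) ^ (1 - z.re) ≤
      A * A * (‖z‖⁻¹ * ‖z‖⁻¹) * (m : ℝ) ^ z.re * (w n * ‖x n‖) := by
    rintro ⟨n, hmn⟩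
    have hmn : m < n := hmn
    have hn : (0 : ℝ) < n := by exact_mod_cast n.pos
    have hrn := Real.rpow_pos_of_pos hn z.re
    have hp : 0 < ‖partialProd z n‖ := norm_pos_iff.mpr (partialProd_ne_zero hz n)
    have hsum : ∑ k ∈ Finset.Icc 1 n, partialProd z k.natPred * (Pi.single m 1 : ℕ+ → ℂ) k =
        partialProd z m.natPred := by
      rw [Finset.sum_eq_single_of_mem m (by simp [hmn.le]) fun k _ hk => by simp [hk]]
      simp
    have h1 := hx n
    rw [Pi.single_eq_of_ne hmn.ne', sum_eq_solPartialSum hz hx, solPartialSum, hsum,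
      sub_eq_zero, inv_mul_eq_iff_eq_mul₀ (norm_pos_iff.mp hz0)] at h1
    have h2 : ‖x n‖ = ‖z‖ * (‖partialProd z n‖⁻¹ * (‖z‖ * ‖partialProd z m.natPred‖) / n) := by
      rw [h1, norm_mul, norm_div, norm_mul, norm_mul, norm_inv, Complex.norm_natCast]
    have h3 : (n : ℝ) ^ z.re ≤ A * A * (m : ℝ) ^ z.re *
        (‖partialProd z n‖⁻¹ * ‖partialProd z m.natPred‖) := by
      rw [← div_eq_inv_mul, mul_div_assoc', le_div_iff₀ hp]
      calc _ ≤ A * 1 := by rw [mul_one]; exact (hP n).1.1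
        _ ≤ A * _ := mul_le_mul_of_nonneg_left (hP m).2.2 hA.le
        _ = _ := by ring
    rw [h2, Real.rpow_sub hn, Real.rpow_one]
    have hw := w.pos n
    calc _ = w n / n * (n : ℝ) ^ z.re := by field_simp
      _ ≤ w n / n * _ := mul_le_mul_of_nonneg_left h3 (by positivity)
      _ = _ := by field_simp
  have hm : (0 : ℝ) < m := by exact_mod_cast m.pos
  have hrm := Real.rpow_pos_of_pos hm z.re
  have hwm := w.pos m
  set B : ℝ := A * A * (‖z‖⁻¹ * ‖z‖⁻¹) * (m : ℝ) ^ z.re with hB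
  have hBpos : 0 ≤ B := by positivity
  have htail : ∑' n : Set.Ioi m, ENNReal.ofReal (w n / ((n : ℕ+) : ℝ) ^ (1 - z.re)) ≤
      ENNReal.ofReal (B * (‖R‖ * w m)) := by
    calc _ ≤ ∑' n : Set.Ioi m, ENNReal.ofReal (B * (w n * ‖x n‖)) :=
          ENNReal.tsum_le_tsum fun n => ENNReal.ofReal_le_ofReal (hxn n)
      _ ≤ ∑' n : ℕ+, ENNReal.ofReal (B * (w n * ‖x n‖)) :=
          ENNReal.tsum_comp_le_tsum_of_injective Subtype.val_injective
            fun n : ℕ+ => ENNReal.ofReal (B * (w n * ‖x n‖))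
      _ = ENNReal.ofReal (B * ‖x‖) := by
          rw [EllOne.norm_def, ← tsum_mul_left, ENNReal.ofReal_tsum_of_nonneg
            (fun n => mul_nonneg hBpos (x.term_nonneg n)) (x.summable.mul_left B)]
      _ ≤ _ := by
          refine ENNReal.ofReal_le_ofReal (mul_le_mul_of_nonneg_left ?_ hBpos)
          rw [← norm_unitVec w m]
          exact R.le_opNorm _
  refine (mul_le_mul_right htail _).trans_eq ?_
  rw [← ENNReal.ofReal_mul (by positivity)]
  congr 1
  rw [hB]
  field_simp

/-! ### The point spectrum -/

/-- The eigenvector `binomSeq m` grows like `n^{m-1}`, which decides when it lies in `ℓ₁(w)`. -/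
theorem binomSeq_mem_iff (w : Weight) (m : ℕ+) :
    binomSeq m ∈ ellOneSubmodule w ↔ (m : ℝ) - 1 ∈ setR w := by
  have hm : (m : ℝ) - 1 = (m.natPred : ℝ) := by
    rw [← m.natPred_add_one]
    push_cast
    ring
  have hnorm : ∀ n, ‖binomSeq m n‖ = (n.natPred.choose m.natPred : ℝ) := fun n =>
    Complex.norm_natCast _
  change (Summable fun n => w n * ‖binomSeq m n‖) ↔ Summable fun n : ℕ+ => (n : ℝ) ^ _ * w n
  simp only [hm, Real.rpow_natCast, hnorm]
  constructor
  · intro h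
    refine Summable.of_norm_bounded_eventually
      (h.mul_left ((m : ℝ) ^ m.natPred * m.natPred.factorial)) ?_
    refine (Set.finite_lt_nat (m : ℕ)).preimage (PNat.coe_injective.injOn) |>.subset ?_
    intro n hbad
    by_contra hlt
    refine hbad ?_
    have hmn : (m : ℕ) ≤ n := not_lt.mp hlt
    change ‖(n : ℝ) ^ m.natPred * w n‖ ≤ _
    rw [Real.norm_of_nonneg (mul_nonneg (by positivity) (w.pos n).le)]
    -- The bound `n ≤ m (n - m + 1)` for `n ≥ m` gives `n^{m-1} ≤ m^{m-1} (n - m + 1)^{m-1}`, and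
    -- `(n - m + 1)^{m-1}` is at most
    -- `(m-1)!` times the binomial coefficient.
    have h1 : (n : ℕ) ≤ m * (n.natPred + 1 - m.natPred) := by
      rw [n.natPred_add_one]
      have h2 := m.natPred_add_one
      obtain ⟨d, hd⟩ := Nat.exists_eq_add_of_le hmn
      have h3 : (n : ℕ) - m.natPred = d + 1 := by omega
      rw [h3, hd]
      nlinarith [m.pos]
    have h2 := Nat.pow_le_choose (α := ℝ) m.natPred n.natPred
    rw [div_le_iff₀ (by positivity)] at h2
    have h3 : (n : ℝ) ^ m.natPred ≤ (m : ℝ) ^ m.natPred *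
        ((n.natPred + 1 - m.natPred : ℕ) : ℝ) ^ m.natPred := by
      rw [← mul_pow]
      gcongr
      exact_mod_cast h1
    calc (n : ℝ) ^ m.natPred * w n
        ≤ (m : ℝ) ^ m.natPred *
          ((n.natPred.choose m.natPred : ℝ) * m.natPred.factorial) * w n := by
          refine mul_le_mul_of_nonneg_right (h3.trans ?_) (w.pos n).le
          gcongr
      _ = _ := by ring
  · intro h
    refine Summable.of_nonneg_of_le (fun n => mul_nonneg (w.pos n).le (Nat.cast_nonneg _))
      (fun n => ?_) h
    rw [mul_comm]
    refine mul_le_mul_of_nonneg_right ?_ (w.pos n).le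
    have h1 : n.natPred.choose m.natPred ≤ (n : ℕ) ^ m.natPred :=
      (Nat.choose_le_pow _ _).trans
        (Nat.pow_le_pow_left ((Nat.le_succ _).trans n.natPred_add_one.le) _)
    exact_mod_cast h1

/-- The first nonzero coordinate of an eigenvector determines the eigenvalue `1/m`, and the
eigenvector is then a multiple of `binomSeq m`. -/
theorem pointSpectrum_cesaroOp (w : Weight) (hC : CesaroActs w) :
    pointSpectrum (cesaroOp w hC) =
      {μ : ℂ | ∃ m : ℕ+, ((m : ℝ) - 1) ∈ setR w ∧ μ = 1 / (m : ℂ)} := by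
  ext μ
  constructor
  · intro h
    obtain ⟨x, hx⟩ := Module.End.HasEigenvalue.exists_hasEigenvector h
    have hx1 : cesaroOp w hC x = μ • x := hx.apply_eq_smul
    have hx2 : ∀ n : ℕ+, (∑ k ∈ Finset.Icc 1 n, x k) / (n : ℂ) = μ * x n := fun n =>
      congrArg (fun v : EllOne w => v n) hx1
    have hne : ∃ n, x n ≠ 0 := by
      by_contra! h0
      exact hx.2 (EllOne.ext h0)
    classical
    obtain ⟨hμ, hb⟩ := eigen_eq_binomSeq hx2 (PNat.find_spec hne)
      fun k hk => not_not.mp (PNat.find_min hne hk)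
    refine ⟨_, (binomSeq_mem_iff w _).mp ?_, hμ⟩
    have h1 := (ellOneSubmodule w).smul_mem (x (PNat.find hne))⁻¹ x.2
    convert h1 using 1
    funext n
    change _ = (x (PNat.find hne))⁻¹ * x n
    rw [hb n, inv_mul_cancel_left₀ (PNat.find_spec hne)]
  · rintro ⟨m, hm, rfl⟩
    refine Module.End.hasEigenvalue_of_hasEigenvector
      (x := (⟨binomSeq m, (binomSeq_mem_iff w m).mpr hm⟩ : EllOne w)) ⟨?_, fun h0 => ?_⟩
    · refine Module.End.mem_eigenspace_iff.mpr ?_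
      exact EllOne.ext fun n => cesaro_binomSeq m n
    · have h1 : binomSeq m m = 0 := congrArg (fun v : EllOne w => v m) h0
      simp [binomSeq] at h1

/-! ### The set `R_w` -/

theorem neg_two_mem_setR {w : Weight} (hw : w.Bounded) : (-2 : ℝ) ∈ setR w := by
  obtain ⟨b, hb⟩ := hw
  have h1 : Summable fun n : ℕ => (n : ℝ) ^ (-2 : ℝ) := Real.summable_nat_rpow.mpr (by norm_num)
  have h2 : Summable fun n : ℕ+ => (n : ℝ) ^ (-2 : ℝ) := h1.comp_injective PNat.coe_injective
  have hr : ∀ n : ℕ+, 0 ≤ (n : ℝ) ^ (-2 : ℝ) := fun n => Real.rpow_nonneg (by positivity) _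
  exact Summable.of_nonneg_of_le (fun n => mul_nonneg (hr n) (w.pos n).le)
    (fun n => mul_le_mul_of_nonneg_left (hb ⟨n, rfl⟩) (hr n)) (h2.mul_right b)

theorem mem_setR_of_le {w : Weight} {s t : ℝ} (hst : s ≤ t) (ht : t ∈ setR w) : s ∈ setR w := by
  have hr : ∀ n : ℕ+, 0 ≤ (n : ℝ) ^ s := fun n => Real.rpow_nonneg (by positivity) _
  refine Summable.of_nonneg_of_le (fun n => mul_nonneg (hr n) (w.pos n).le) (fun n => ?_) ht
  refine mul_le_mul_of_nonneg_right ?_ (w.pos n).le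
  exact Real.rpow_le_rpow_of_exponent_le (by exact_mod_cast n.pos) hst

theorem isLUB_tZero {w : Weight} (hw : w.Bounded) (h : setR w ≠ Set.univ) :
    IsLUB (setR w) (tZero w) := by
  obtain ⟨t, ht⟩ := (Set.ne_univ_iff_exists_notMem _).mp h
  exact isLUB_csSup ⟨_, neg_two_mem_setR hw⟩
    ⟨t, fun s hs => le_of_not_ge fun hts => ht (mem_setR_of_le hts hs)⟩

theorem finite_setOf_one_div_le (t : ℝ) :
    {μ : ℂ | ∃ m : ℕ+, (m : ℝ) ≤ t ∧ μ = 1 / (m : ℂ)}.Finite := by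
  have h : {m : ℕ+ | (m : ℝ) ≤ t}.Finite := by
    refine ((Set.finite_le_nat ⌊t⌋₊).preimage PNat.coe_injective.injOn).subset fun m hm => ?_
    exact Nat.le_floor hm
  refine (h.image fun m : ℕ+ => 1 / (m : ℂ)).subset ?_
  rintro μ ⟨m, hm, rfl⟩
  exact ⟨m, hm, rfl⟩

end WeightedCesaro
end

theorem theorem3p7 (w : Weight) (hw : w.Bounded) (hC : CesaroActs w) :
    (sigmaSet ⊆ sigmaSet₀ ∧ sigmaSet₀ ⊆ spectrum ℂ (cesaroOp w hC)) ∧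
    (∀ l : ℂ, l ∉ sigmaSet₀ →
      (l ∈ resolventSet ℂ (cesaroOp w hC) ↔ resolventSup w (1 / l).re < ⊤)) ∧
    (setR w ≠ Set.univ →
      IsLUB (setR w) (tZero w) ∧
      pointSpectrum (cesaroOp w hC) =
        {μ : ℂ | ∃ m : ℕ+, ((m : ℝ) - 1) ∈ setR w ∧ μ = 1 / (m : ℂ)} ∧
      pointSpectrum (cesaroOp w hC) ⊆
        {μ : ℂ | ∃ m : ℕ+, (m : ℝ) ≤ tZero w + 1 ∧ μ = 1 / (m : ℂ)} ∧
      (pointSpectrum (cesaroOp w hC)).Finite) ∧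
    (setR w = Set.univ → pointSpectrum (cesaroOp w hC) = sigmaSet) := by
  refine ⟨⟨Set.subset_union_right, sigmaSet₀_subset_spectrum w hC⟩, fun l hl =>
    ⟨resolventSup_lt_top_of_mem_resolventSet w hC hl,
      mem_resolventSet_of_resolventSup_lt_top w hC hl⟩, fun hR => ?_, fun hR => ?_⟩
  · have hlub := isLUB_tZero hw hR
    have hsub : pointSpectrum (cesaroOp w hC) ⊆
        {μ : ℂ | ∃ m : ℕ+, (m : ℝ) ≤ tZero w + 1 ∧ μ = 1 / (m : ℂ)} := by
      rw [pointSpectrum_cesaroOp]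
      rintro μ ⟨m, hm, rfl⟩
      exact ⟨m, sub_le_iff_le_add.mp (hlub.1 hm), rfl⟩
    exact ⟨hlub, pointSpectrum_cesaroOp w hC, hsub, (finite_setOf_one_div_le _).subset hsub⟩
  · rw [pointSpectrum_cesaroOp, hR]
    simp [sigmaSet]
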